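/- **Setting.** Let $p(x,y)=p(0,y-x)$, where $p(0,\cdot)$ is a $C^\infty$ probability density on $\mathbb R$ with $p(0,z)=0$ for $|z|\ge\xi$ ($\xi>0$), and let $\rho_0$ be a $C^\infty$ probability density with support in $[-A,A]$ ($A>0$); both are fixed. *Basic process* $\underline y(t)$, $t\ge0$: each particle carries an independent exponential clock of intensity $1$; each time the clock of a particle rings, the particle (then at $x$) creates a new particle at a position $y$ chosen with density $p(x,y)\,dy$, and stays alive. Otherwise particles move as independent standard Brownian motions. There are no deaths. $P^{\underline y_0}$ is its law when started from the configuration $\underline y_0$. *Stochastic barriers*, $\delta>0$, starting from a configuration $\underline x(0)$ of $N$ particles; they are realized as subsets of the basic process started from $\underline x(0)$. - Upper barrier $\underline x^{\delta,+}$: $\underline x^{\delta,+}(0^+)=\underline x(0)$; during $(k\delta,(k+1)\delta)$, $k\ge0$, it evolves as the basic process; at each time $k\delta$, $k\ge1$, only the $N$ rightmost particles are kept (all of them if there are fewer). - Lower barrier $\underline x^{\delta,-}$, with a parameter $\alpha_0\in(\frac12,1)$: let $M_\delta=(1-e^{-\delta})N+N^{\alpha_0}$, rounded to a neighbouring integer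 (either one). At time $0$ the $M_\delta$ leftmost particles are deleted (all of them if $M_\delta\ge N$). During $(k\delta,(k+1)\delta)$, $k\ge 0$, it evolves as the basic process, except that, from the first time in this interval at which there are $N$ particles, branching is switched off until $(k+1)\delta$. At each time $k\delta$, $k\ge1$, only the $\max(N-M_\delta,0)$ rightmost particles are kept. **Theorem.** For all $T>0$ and $b>0$ there is a constant $c_{b,T}$ (which may depend also on the fixed $p,\rho_0,\xi,A$, but not on $N$, $\delta$, $\alpha_0$ or the starting configuration) such that for every integer $N\ge1$: 1. for every configuration $\underline y_0$ of at most $N$ particles, all in $[-A,A]$, $$P^{\underline y_0}\Big[\underline y(t)\subset[-N^b,N^b]\ \text{ for all } 0\le t\le T\Big]\ \ge\ 1-c_{b,T}\,N^{-1};$$ 2. if $\underline x(0)$ consists of $N$ particles, either at fixed positions in $[-A,A]$ or at independent random positions with density $\rho_0$ (independent of the subsequent evolution), then for every $\delta>0$, and every $\alpha_0\in(\frac12,1)$ in the case of the lower barrier, $\underline x^{\delta,\pm}(t)$ is a subset of the basic process at time $t$, and $$P\Big[\underline x^{\delta,\pm}(t)\subset[-N^b,N^b]\ \text{ for all } 0\le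 t\le T\Big]\ \ge\ 1-c_{b,T}\,N^{-1},$$ where at the times $k\delta$ the configurations before and after the deletion of particles are both included. -/

import Mathlib

open MeasureTheory ProbabilityTheory Set
open scoped NNReal

noncomputable section

namespace BranchingBrownian

/-! ### The data of the model -/

/-- `p x y` is the density in `y` of the position of a particle created by a particle at `x`:
translation invariant, smooth, of finite range `ξ`. -/
structure IsJumpDensity (p : ℝ → ℝ → ℝ) (ξ : ℝ) : Prop where
  range_pos : 0 < ξ
  translation_invariant : ∀ x y, p x y = p 0 (y - x)
  smooth : ContDiff ℝ (⊤ : ℕ∞) (p 0)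
  nonneg : ∀ z, 0 ≤ p 0 z
  integral_eq_one : ∫ z, p 0 z = 1
  finite_range : ∀ z, ξ ≤ |z| → p 0 z = 0

/-- `ρ₀` is a smooth probability density with support in `[-A, A]`. -/
structure IsInitialDensity (ρ₀ : ℝ → ℝ) (A : ℝ) : Prop where
  pos : 0 < A
  smooth : ContDiff ℝ (⊤ : ℕ∞) ρ₀
  nonneg : ∀ r, 0 ≤ ρ₀ r
  integral_eq_one : ∫ r, ρ₀ r = 1
  support : ∀ r, r ∉ Icc (-A) A → ρ₀ r = 0

/-! ### The basic process, realisation by realisation -/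

/-- Genealogical labels: `(i, [])` is the `i`-th initial particle and `(i, k :: u)` is the particle
created when the clock of particle `(i, u)` rings for the `(k + 1)`-st time. -/
abbrev Label (n : ℕ) : Type := Fin n × List ℕ

/-- One realisation of the randomness that drives the process started from `n` particles. -/
structure Sample (n : ℕ) where
  /-- initial positions -/
  start : Fin n → ℝ
  /-- `clock u k`: waiting time between the `k`-th and the `(k + 1)`-st ring of the clock of `u`
  (counted from the birth of `u` when `k = 0`) -/
  clock : Label n → ℕ → ℝ
  /-- `jump u k`: displacement, from its parent, of the particle created by the `(k + 1)`-st ring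
  of the clock of `u` -/
  jump : Label n → ℕ → ℝ
  /-- `path u a`: displacement of `u` since its birth, at age `a` -/
  path : Label n → ℝ≥0 → ℝ

namespace Sample

variable {n : ℕ} (s : Sample n)

/-- Time at which a particle is created. -/
def birth (i : Fin n) : List ℕ → ℝ
  | [] => 0
  | k :: u => birth i u + ∑ j ∈ Finset.range (k + 1), s.clock (i, u) j

/-- Place at which a particle is created: the position of the parent at that time plus the jump. -/
def birthPlace (i : Fin n) : List ℕ → ℝ
  | [] => s.start i
  | k :: u => birthPlace i u + s.path (i, u) (s.birth i (k :: u) - s.birth i u).toNNReal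
      + s.jump (i, u) k

/-- Position of particle `u` at time `t` (meaningful once `u` is born). -/
def pos (u : Label n) (t : ℝ) : ℝ :=
  s.birthPlace u.1 u.2 + s.path u (t - s.birth u.1 u.2).toNNReal

/-- The basic process at time `t`: all the particles created up to time `t`. -/
def basic (t : ℝ) : Set (Label n) := {u | s.birth u.1 u.2 ≤ t}

/-- All the particles of the set `S`, at time `t`, lie in `[-R, R]`. -/
def Confined (S : Set (Label n)) (t R : ℝ) : Prop := ∀ u ∈ S, s.pos u t ∈ Icc (-R) R

/-! ### The stochastic barriers, as subsets of the basic process -/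

/-- The basic process at time `t`, when restarted at time `t₀` from the set of particles `S`:
`S` together with the descendants of `S` through births during `(t₀, t]`. -/
inductive Evolve (S : Set (Label n)) (t₀ t : ℝ) : Label n → Prop
  | mem {u : Label n} : u ∈ S → Evolve S t₀ t u
  | branch {i : Fin n} {u : List ℕ} {k : ℕ} : Evolve S t₀ t (i, u) →
      t₀ < s.birth i (k :: u) → s.birth i (k :: u) ≤ t → Evolve S t₀ t (i, k :: u)

/-- The set of particles described by `Evolve`. -/
def evolve (S : Set (Label n)) (t₀ t : ℝ) : Set (Label n) := {u | s.Evolve S t₀ t u}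

/-- As `evolve`, but branching is switched off as soon as there are `N` particles: a new particle
is kept only if the number of particles was never equal to `N` before its birth. -/
def evolveStopped (N : ℕ) (S : Set (Label n)) (t₀ t : ℝ) : Set (Label n) :=
  {u | u ∈ s.evolve S t₀ t ∧
    (u ∈ S ∨ ∀ r, t₀ ≤ r → r < s.birth u.1 u.2 → (s.evolve S t₀ r).encard ≠ N)}

/-- The `m` rightmost particles of `S` at time `t` (all of `S` if it has at most `m` elements);
particles at the same place are ordered by an enumeration of the labels. -/
def rightmost (S : Set (Label n)) (m : ℕ) (t : ℝ) : Set (Label n) :=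
  {u | u ∈ S ∧ {v | v ∈ S ∧ (s.pos u t < s.pos v t ∨
    (s.pos v t = s.pos u t ∧ Encodable.encode v < Encodable.encode u))}.encard < m}

/-- The initial particles. -/
def roots (n : ℕ) : Set (Label n) := {u | u.2 = []}

/-- The upper barrier immediately after the cut at time `k δ`. -/
def upperAfterCut (N : ℕ) (δ : ℝ) : ℕ → Set (Label n)
  | 0 => roots n
  | k + 1 => s.rightmost (s.evolve (upperAfterCut N δ k) (k * δ) ((k + 1) * δ)) N ((k + 1) * δ)

/-- The upper barrier at a time `t` between the cut at `k δ` and the cut at `(k + 1) δ`.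
At `t = k δ` it is the configuration after the cut, at `t = (k + 1) δ` the one before the cut. -/
def upper (N : ℕ) (δ : ℝ) (k : ℕ) (t : ℝ) : Set (Label n) :=
  s.evolve (s.upperAfterCut N δ k) (k * δ) t

/-- The lower barrier immediately after the cut at time `k δ`; `M` is the number of particles
that are cut at time `0`. -/
def lowerAfterCut (N M : ℕ) (δ : ℝ) : ℕ → Set (Label n)
  | 0 => s.rightmost (roots n) (N - M) 0
  | k + 1 => s.rightmost (s.evolveStopped N (lowerAfterCut N M δ k) (k * δ) ((k + 1) * δ))
      (N - M) ((k + 1) * δ)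

/-- The lower barrier at a time `t` between the cut at `k δ` and the cut at `(k + 1) δ`, with the
same convention as `upper` at the two end points. -/
def lower (N M : ℕ) (δ : ℝ) (k : ℕ) (t : ℝ) : Set (Label n) :=
  s.evolveStopped N (s.lowerAfterCut N M δ k) (k * δ) t

end Sample

/-! ### Probability -/

section Probability

variable {Ω : Type*} {n : ℕ}

/-- The σ-algebras generated by each Brownian path, each waiting time and each jump. -/
@[reducible] def noiseSigma (B : Label n → ℝ≥0 → Ω → ℝ) (τ Z : Label n → ℕ → Ω → ℝ) :
    Label n ⊕ (Label n × ℕ) ⊕ (Label n × ℕ) → MeasurableSpace Ω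
  | .inl u => MeasurableSpace.comap (fun ω a => B u a ω) MeasurableSpace.pi
  | .inr (.inl q) => MeasurableSpace.comap (τ q.1 q.2) (borel ℝ)
  | .inr (.inr q) => MeasurableSpace.comap (Z q.1 q.2) (borel ℝ)

/-- The driving randomness of the basic process: for every label, a standard Brownian motion,
exponential waiting times of intensity `1` and jumps with density `p 0`, all independent. -/
structure IsNoise [MeasurableSpace Ω] (p : ℝ → ℝ → ℝ) (B : Label n → ℝ≥0 → Ω → ℝ)
    (τ Z : Label n → ℕ → Ω → ℝ) (P : Measure Ω) : Prop where
  measurable_path : ∀ u a, Measurable (B u a)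
  measurable_clock : ∀ u k, Measurable (τ u k)
  measurable_jump : ∀ u k, Measurable (Z u k)
  brownian : ∀ u, IsBrownianReal (B u) P
  clock_law : ∀ u k, HasLaw (τ u k) (expMeasure 1) P
  jump_law : ∀ u k, HasLaw (Z u k) (volume.withDensity fun z => ENNReal.ofReal (p 0 z)) P
  indep : iIndep (noiseSigma B τ Z) P

/-- The initial positions are independent with density `ρ₀`, and independent of the noise. -/
structure IsIIDStart [MeasurableSpace Ω] (ρ₀ : ℝ → ℝ) (x₀ : Fin n → Ω → ℝ)
    (B : Label n → ℝ≥0 → Ω → ℝ) (τ Z : Label n → ℕ → Ω → ℝ) (P : Measure Ω) : Prop where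
  measurable : ∀ i, Measurable (x₀ i)
  law : ∀ i, HasLaw (x₀ i) (volume.withDensity fun r => ENNReal.ofReal (ρ₀ r)) P
  iIndep_start : iIndepFun x₀ P
  indep_noise : Indep (⨆ i, MeasurableSpace.comap (x₀ i) (borel ℝ)) (⨆ j, noiseSigma B τ Z j) P

/-- The realisation at `ω`. -/
def sampleAt (x₀ : Fin n → Ω → ℝ) (B : Label n → ℝ≥0 → Ω → ℝ) (τ Z : Label n → ℕ → Ω → ℝ)
    (ω : Ω) : Sample n where
  start i := x₀ i ω
  clock u k := τ u k ω
  jump u k := Z u k ω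
  path u a := B u a ω

/-- `E` holds with probability at least `q`: it contains a measurable set of probability at least
`q`. For a measurable `E` this is `q ≤ P E`. -/
def ProbAtLeast [MeasurableSpace Ω] (P : Measure Ω) (E : Set Ω) (q : ℝ) : Prop :=
  ∃ G, MeasurableSet G ∧ G ⊆ E ∧ q ≤ P.real G

end Probability

end BranchingBrownian

end

open scoped ENNReal

/-! The proof is a union bound over all genealogical labels, with a moment of order `q` and an
exponential discount of the birth time. The position of a particle up to time T is at most the sum
of the initial position, the jumps and the path suprema along its ancestral line. This sum is
dominated by 1 + A times the product over that line of 1 + ξ + sup |B|. The requirement that the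
particle be born before T is replaced by the weight exp(λ(T - birth)), which is at least 1 on that
event (`IsRegular.le_prod_factor`). Suprema are taken over all of [0, T], not over actual lifetimes,
so the bound is a product of functions of distinct independent sources, and its expectation
factorizes.

Let C bound the `q`-th moment of 1 + ξ + sup |B|; it is finite by a maximal inequality with
exponential tails. Passing to child number k multiplies the expectation by C (1 + λ)^-(k+1), so all
children together contribute C/λ. With λ = 2(C + 1) this ratio is below 1/2, and the sum over the
whole infinite tree of one root is at most 2C. Markov's inequality then bounds the escape
probability from [-R, R] by a constant times n / R^q. For R = N^b, bq ≥ 2 and n ≤ N this is of order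
1/N.

The barriers are subsets of the basic process for every realisation, so the same event confines
them. -/

namespace BranchingBrownian

/-! ### Deterministic part -/

/-- Supremum of `|f|` over a countable dense subset of `[0, T]`. -/
noncomputable def pathSup (T : ℝ≥0) (f : ℝ≥0 → ℝ) : ℝ≥0∞ :=
  ⨆ m, ‖f (TopologicalSpace.denseSeq (Iic T) m)‖ₑ

lemma enorm_le_pathSup {T : ℝ≥0} {f : ℝ≥0 → ℝ} (hf : Continuous f) {a : ℝ≥0} (ha : a ≤ T) :
    ‖f a‖ₑ ≤ pathSup T f := by
  have key : ∀ x : Iic T, ‖f x‖ₑ ≤ pathSup T f := by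
    refine isClosed_property (TopologicalSpace.denseRange_denseSeq (Iic T)) ?_ fun m => ?_
    · exact isClosed_le (by fun_prop) continuous_const
    · exact le_iSup (fun m => ‖f (TopologicalSpace.denseSeq (Iic T) m)‖ₑ) m
  exact key ⟨a, ha⟩

/-- Indices of the noise: Brownian paths, waiting times and jumps. -/
abbrev NoiseIndex (n : ℕ) : Type := Label n ⊕ (Label n × ℕ) ⊕ (Label n × ℕ)

/-- The Brownian paths and the waiting times that determine the birth of a particle and the
size of the displacement of its ancestral line. -/
def lineage {n : ℕ} (i : Fin n) : List ℕ → Finset (NoiseIndex n)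
  | [] => {.inl (i, [])}
  | k :: l => lineage i l ∪ ((Finset.range (k + 1)).image (fun j => .inr (.inl ((i, l), j))) ∪
      {.inl (i, k :: l)})

lemma length_le_of_inl_mem_lineage {n : ℕ} {i : Fin n} {l : List ℕ} {u : Label n}
    (h : Sum.inl u ∈ lineage i l) : u.2.length ≤ l.length := by
  induction l with
  | nil => simp [lineage] at h; simp [h]
  | cons k l ih =>
    simp only [lineage, Finset.mem_union, Finset.mem_image, Finset.mem_singleton, reduceCtorEq,
      and_false, exists_false, false_or, Sum.inl.injEq] at h
    rcases h with h | h
    · exact (ih h).trans (by simp)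
    · simp [h]

lemma length_lt_of_inr_mem_lineage {n : ℕ} {i : Fin n} {l : List ℕ} {q : Label n × ℕ}
    (h : Sum.inr (Sum.inl q) ∈ lineage i l) : q.1.2.length < l.length := by
  induction l with
  | nil => simp [lineage] at h
  | cons k l ih =>
    simp only [lineage, Finset.mem_union, Finset.mem_image, Finset.mem_singleton, reduceCtorEq,
      or_false, Sum.inr.injEq, Sum.inl.injEq] at h
    rcases h with h | ⟨j, -, rfl⟩
    · exact (ih h).trans (by simp)
    · simp

/-- Label lengths separate the generations: the clock of `(i, l)` and the path of `(i, k :: l)` do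
not occur in `lineage i l`. No source is counted twice, so independence applies to the product as it
stands. -/
lemma prod_lineage_cons {n : ℕ} (i : Fin n) (k : ℕ) (l : List ℕ) (h : NoiseIndex n → ℝ≥0∞) :
    ∏ j ∈ lineage i (k :: l), h j = (∏ j ∈ lineage i l, h j) *
      ((∏ j ∈ Finset.range (k + 1), h (.inr (.inl ((i, l), j)))) * h (.inl (i, k :: l))) := by
  rw [lineage, Finset.prod_union, Finset.prod_union, Finset.prod_image, Finset.prod_singleton]
  · intro a _ b _ hab
    simpa using hab
  · simp
  · rw [Finset.disjoint_left]
    intro a ha hb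
    simp only [Finset.mem_union, Finset.mem_image, Finset.mem_singleton] at hb
    rcases hb with ⟨j, -, rfl⟩ | rfl
    · exact absurd (length_lt_of_inr_mem_lineage ha) (by simp)
    · exact absurd (length_le_of_inl_mem_lineage ha) (by simp)

namespace Sample

variable {n : ℕ} (s : Sample n)

/-- A bound for the displacement of the ancestral line of a particle. -/
noncomputable def envelope (ξ : ℝ) (T : ℝ≥0) (i : Fin n) : List ℕ → ℝ≥0∞
  | [] => 1 + ENNReal.ofReal ξ + pathSup T (s.path (i, []))
  | k :: l => envelope ξ T i l * (1 + ENNReal.ofReal ξ + pathSup T (s.path (i, k :: l)))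

/-- The factor that each source of noise contributes to the moment bound. -/
noncomputable def factor (ξ : ℝ) (T : ℝ≥0) (lam : ℝ) (q : ℕ) : NoiseIndex n → ℝ≥0∞
  | .inl u => (1 + ENNReal.ofReal ξ + pathSup T (s.path u)) ^ q
  | .inr (.inl v) => ENNReal.ofReal (Real.exp (-lam * s.clock v.1 v.2))
  | .inr (.inr _) => 1

/-- A birth time is the sum of the waiting times in the lineage, so their discounts multiply up to
the discount of the birth. Jumps are absent because the bound ξ already accounts for them. -/
lemma prod_factor_lineage (ξ : ℝ) (T : ℝ≥0) (lam : ℝ) (q : ℕ) (i : Fin n) (l : List ℕ) :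
    ∏ j ∈ lineage i l, s.factor ξ T lam q j =
      s.envelope ξ T i l ^ q * ENNReal.ofReal (Real.exp (-lam * s.birth i l)) := by
  induction l with
  | nil => simp [lineage, factor, envelope, birth]
  | cons k l ih =>
    rw [prod_lineage_cons, ih]
    simp only [factor, envelope, birth]
    rw [← ENNReal.ofReal_prod_of_nonneg (fun _ _ => (Real.exp_pos _).le), ← Real.exp_sum,
      ← Finset.mul_sum, mul_add (-lam), Real.exp_add, ENNReal.ofReal_mul (Real.exp_pos _).le, mul_pow]
    ring

/-- The almost sure properties of a realisation. -/
structure IsRegular (ξ A : ℝ) : Prop where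
  clock_nonneg : ∀ u k, 0 ≤ s.clock u k
  continuous_path : ∀ u, Continuous (s.path u)
  abs_jump_le : ∀ u k, |s.jump u k| ≤ ξ
  abs_start_le : ∀ i, |s.start i| ≤ A

variable {s} {ξ A : ℝ}

lemma IsRegular.birth_le_cons (hs : s.IsRegular ξ A) (i : Fin n) (k : ℕ) (l : List ℕ) :
    s.birth i l ≤ s.birth i (k :: l) := by
  rw [birth]
  exact le_add_of_nonneg_right (Finset.sum_nonneg fun j _ => hs.clock_nonneg _ _)

lemma IsRegular.birth_nonneg (hs : s.IsRegular ξ A) (i : Fin n) (l : List ℕ) :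
    0 ≤ s.birth i l := by
  induction l with
  | nil => simp [birth]
  | cons k l ih => exact ih.trans (hs.birth_le_cons i k l)

lemma one_le_envelope (T : ℝ≥0) (i : Fin n) (l : List ℕ) : 1 ≤ s.envelope ξ T i l := by
  induction l with
  | nil => rw [envelope, add_assoc]; exact le_self_add
  | cons k l ih =>
    rw [envelope, add_assoc]
    exact one_le_mul ih le_self_add

/-- A product of terms that are at least 1 absorbs sums: x ≤ Q and 1 ≤ Q give x + ξ + S ≤ Q(1 + ξ +
S). The path supremum of the particle itself belongs to the induction hypothesis, since its children
are born along that path. -/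
lemma IsRegular.birthPlace_le (hs : s.IsRegular ξ A) {T : ℝ≥0} {i : Fin n} {l : List ℕ}
    (hl : s.birth i l ≤ T) :
    1 + ‖s.birthPlace i l‖ₑ + pathSup T (s.path (i, l)) ≤
      (1 + ENNReal.ofReal A) * s.envelope ξ T i l := by
  induction l with
  | nil =>
    have h0 : ‖s.start i‖ₑ ≤ ENNReal.ofReal A := by
      rw [Real.enorm_eq_ofReal_abs]
      exact ENNReal.ofReal_le_ofReal (hs.abs_start_le i)
    rw [birthPlace, envelope]
    calc _ ≤ 1 + ENNReal.ofReal A + 1 * (pathSup T (s.path (i, []))) := by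
          rw [one_mul]; gcongr
      _ ≤ (1 + ENNReal.ofReal A) * 1 + (1 + ENNReal.ofReal A) * (pathSup T (s.path (i, []))) := by
          rw [mul_one]
          gcongr
          exact le_self_add
      _ ≤ _ := by
          rw [← mul_add]
          gcongr
          exact le_self_add
  | cons k l ih =>
    have hle := hs.birth_le_cons i k l
    have ih := ih (hle.trans hl)
    have hj : ‖s.jump (i, l) k‖ₑ ≤ ENNReal.ofReal ξ := by
      rw [Real.enorm_eq_ofReal_abs]
      exact ENNReal.ofReal_le_ofReal (hs.abs_jump_le _ _)
    have hp : ‖s.path (i, l) (s.birth i (k :: l) - s.birth i l).toNNReal‖ₑ ≤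
        pathSup T (s.path (i, l)) := by
      refine enorm_le_pathSup (hs.continuous_path _) ?_
      rw [Real.toNNReal_le_iff_le_coe]
      linarith [hs.birth_nonneg i l]
    set Q := (1 + ENNReal.ofReal A) * s.envelope ξ T i l with hQ
    have hQ1 : 1 ≤ Q := one_le_mul le_self_add (one_le_envelope T i l)
    set S := pathSup T (s.path (i, k :: l))
    rw [envelope, ← mul_assoc, ← hQ, birthPlace]
    calc _ ≤ 1 + (‖s.birthPlace i l‖ₑ + pathSup T (s.path (i, l)) + ENNReal.ofReal ξ) + S := by
          gcongr
          refine (enorm_add_le _ _).trans ?_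
          gcongr
          refine (enorm_add_le _ _).trans ?_
          gcongr
      _ = (1 + ‖s.birthPlace i l‖ₑ + pathSup T (s.path (i, l))) +
            1 * ENNReal.ofReal ξ + 1 * S := by ring
      _ ≤ Q + Q * ENNReal.ofReal ξ + Q * S := by gcongr
      _ = _ := by ring

lemma IsRegular.pos_le (hs : s.IsRegular ξ A) {T : ℝ≥0} {u : Label n} {t : ℝ}
    (ht : t ≤ T) (hu : s.birth u.1 u.2 ≤ t) :
    ‖s.pos u t‖ₑ ≤ (1 + ENNReal.ofReal A) * s.envelope ξ T u.1 u.2 := by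
  refine le_trans ?_ (hs.birthPlace_le (hu.trans ht))
  have hp : ‖s.path u (t - s.birth u.1 u.2).toNNReal‖ₑ ≤ pathSup T (s.path u) := by
    refine enorm_le_pathSup (hs.continuous_path _) ?_
    rw [Real.toNNReal_le_iff_le_coe]
    linarith [hs.birth_nonneg u.1 u.2]
  rw [pos]
  refine (enorm_add_le _ _).trans ?_
  gcongr
  exact le_add_self

/-- If a particle born before time `T` leaves `[-R, R]` before `T`, the product of the factors of
its lineage is large. -/
lemma IsRegular.le_prod_factor (hs : s.IsRegular ξ A) {T : ℝ≥0} {lam : ℝ} (hlam : 0 ≤ lam) (q : ℕ)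
    {u : Label n} {t R : ℝ} (ht : t ≤ T) (hu : s.birth u.1 u.2 ≤ t) (hR : s.pos u t ∉ Icc (-R) R) :
    ENNReal.ofReal R ^ q ≤ ENNReal.ofReal (Real.exp (lam * T)) * (1 + ENNReal.ofReal A) ^ q *
      ∏ j ∈ lineage u.1 u.2, s.factor ξ T lam q j := by
  rw [prod_factor_lineage]
  have h1 : ENNReal.ofReal R ≤ (1 + ENNReal.ofReal A) * s.envelope ξ T u.1 u.2 := by
    refine le_trans ?_ (hs.pos_le ht hu)
    rw [Real.enorm_eq_ofReal_abs]
    refine ENNReal.ofReal_le_ofReal ?_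
    rw [mem_Icc, ← abs_le, not_le] at hR
    exact hR.le
  have h2 : 1 ≤ ENNReal.ofReal (Real.exp (lam * T)) *
      ENNReal.ofReal (Real.exp (-lam * s.birth u.1 u.2)) := by
    rw [← ENNReal.ofReal_mul (Real.exp_pos _).le, ← Real.exp_add, ENNReal.one_le_ofReal,
      Real.one_le_exp_iff]
    nlinarith
  calc _ ≤ 1 * ((1 + ENNReal.ofReal A) * s.envelope ξ T u.1 u.2) ^ q := by
        rw [one_mul]; gcongr
    _ ≤ (ENNReal.ofReal (Real.exp (lam * T)) *
      ENNReal.ofReal (Real.exp (-lam * s.birth u.1 u.2))) *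
        ((1 + ENNReal.ofReal A) * s.envelope ξ T u.1 u.2) ^ q := by gcongr
    _ = _ := by rw [mul_pow]; ring

/-! ### The barriers are subsets of the basic process -/

variable (s)

lemma rightmost_subset (S : Set (Label n)) (m : ℕ) (t : ℝ) : s.rightmost S m t ⊆ S :=
  fun _ h => h.1

lemma evolve_subset_basic {S : Set (Label n)} {t₀ t : ℝ} (hS : S ⊆ s.basic t₀) (h : t₀ ≤ t) :
    s.evolve S t₀ t ⊆ s.basic t := by
  intro u hu
  -- Only the last step matters: a particle added by branching carries the bound on its own birth
  -- time, so no induction on its ancestors is needed.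
  cases hu with
  | mem hu => exact le_trans (hS hu) h
  | branch _ _ h2 => exact h2

lemma evolveStopped_subset_basic (N : ℕ) {S : Set (Label n)} {t₀ t : ℝ} (hS : S ⊆ s.basic t₀)
    (h : t₀ ≤ t) : s.evolveStopped N S t₀ t ⊆ s.basic t :=
  fun _ hu => s.evolve_subset_basic hS h hu.1

lemma roots_subset_basic : roots n ⊆ s.basic 0 := by
  rintro ⟨i, l⟩ rfl
  exact le_refl (0 : ℝ)

lemma upperAfterCut_subset_basic (N : ℕ) {δ : ℝ} (hδ : 0 < δ) (k : ℕ) :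
    s.upperAfterCut N δ k ⊆ s.basic (k * δ) := by
  induction k with
  | zero => simpa [upperAfterCut] using s.roots_subset_basic
  | succ k ih =>
    rw [upperAfterCut]
    push_cast
    exact (s.rightmost_subset _ _ _).trans (s.evolve_subset_basic ih (by nlinarith))

lemma upper_subset_basic (N : ℕ) {δ : ℝ} (hδ : 0 < δ) (k : ℕ) {t : ℝ} (ht : k * δ ≤ t) :
    s.upper N δ k t ⊆ s.basic t :=
  s.evolve_subset_basic (s.upperAfterCut_subset_basic N hδ k) ht

lemma lowerAfterCut_subset_basic (N M : ℕ) {δ : ℝ} (hδ : 0 < δ) (k : ℕ) :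
    s.lowerAfterCut N M δ k ⊆ s.basic (k * δ) := by
  induction k with
  | zero => simpa [lowerAfterCut] using (s.rightmost_subset _ _ _).trans s.roots_subset_basic
  | succ k ih =>
    rw [lowerAfterCut]
    push_cast
    exact (s.rightmost_subset _ _ _).trans (s.evolveStopped_subset_basic N ih (by nlinarith))

lemma lower_subset_basic (N M : ℕ) {δ : ℝ} (hδ : 0 < δ) (k : ℕ) {t : ℝ} (ht : k * δ ≤ t) :
    s.lower N M δ k t ⊆ s.basic t :=
  s.evolveStopped_subset_basic N (s.lowerAfterCut_subset_basic N M hδ k) ht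

end Sample


/-! ### The supremum of a Brownian path -/

section Brownian

variable {Ω : Type*} [MeasurableSpace Ω] {P : Measure Ω} {B : ℝ≥0 → Ω → ℝ}

lemma lintegral_exp_of_hasLaw_gaussianReal {X : Ω → ℝ} {v : ℝ≥0} (hX : HasLaw X (gaussianReal 0 v) P) :
    ∫⁻ ω, ENNReal.ofReal (Real.exp (X ω)) ∂P = ENNReal.ofReal (Real.exp (v / 2)) := by
  have h : ∫⁻ ω, ENNReal.ofReal (Real.exp (X ω)) ∂P =
      ∫⁻ x, ENNReal.ofReal (Real.exp x) ∂(gaussianReal 0 v) := by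
    rw [← hX.map_eq, lintegral_map' (by fun_prop) hX.aemeasurable]
  have hmgf := congrFun (mgf_fun_id_gaussianReal (μ := 0) (v := v)) 1
  rw [mgf] at hmgf
  simp only [one_mul, zero_add, one_pow, mul_one] at hmgf
  have hint : Integrable (fun x => Real.exp x) (gaussianReal 0 v) := by
    simpa using integrable_exp_mul_gaussianReal (μ := 0) (v := v) 1
  rw [h, ← ofReal_integral_eq_lintegral_ofReal hint (ae_of_all _ fun x => (Real.exp_pos x).le), hmgf]

/-- A maximal inequality for Brownian motion along finitely many times. -/
lemma measure_exists_le_brownian_mul_le (hB : IsPreBrownianReal B P) (hm : ∀ a, Measurable (B a))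
    {T : ℝ≥0} (I : Finset ℝ≥0) (hI : ∀ a ∈ I, a ≤ T) (x : ℝ) :
    P {ω | ∃ a ∈ I, x ≤ B a ω} * ENNReal.ofReal (Real.exp x) ≤
      ENNReal.ofReal (Real.exp (T / 2)) := by
  -- `D a` is the event that `a` is the first time of `I` at which the level `x` is reached.
  let D : ℝ≥0 → Set Ω := fun a => {ω | x ≤ B a ω ∧ ∀ c ∈ I, c < a → B c ω < x}
  have hDm : ∀ a, MeasurableSet (D a) := by
    intro a
    refine (measurableSet_le measurable_const (hm a)).inter ?_
    have : {ω | ∀ c ∈ I, c < a → B c ω < x} = ⋂ c ∈ I, ⋂ (_ : c < a), {ω | B c ω < x} := by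
      ext; simp
    change MeasurableSet {ω | ∀ c ∈ I, c < a → B c ω < x}
    rw [this]
    exact Finset.measurableSet_biInter _ fun c _ => MeasurableSet.iInter fun _ =>
      measurableSet_lt (hm c) measurable_const
  have hdisj : Set.PairwiseDisjoint (↑I) D := by
    intro a ha c hc hac
    rw [Function.onFun, Set.disjoint_left]
    rintro ω ⟨h1, h2⟩ ⟨h3, h4⟩
    rcases lt_or_gt_of_ne hac with h | h
    · exact absurd (h4 a ha h) (not_lt.2 h1)
    · exact absurd (h2 c hc h) (not_lt.2 h3)
  have hcover : {ω | ∃ a ∈ I, x ≤ B a ω} ⊆ ⋃ a ∈ I, D a := by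
    rintro ω ⟨a, ha, hx⟩
    obtain ⟨c, hc, hmin⟩ := Finset.exists_min_image (I.filter fun a => x ≤ B a ω) id
      ⟨a, by simp [ha, hx]⟩
    simp only [Finset.mem_filter, id] at hc hmin
    simp only [mem_iUnion]
    refine ⟨c, hc.1, hc.2, fun e he hec => ?_⟩
    by_contra hcon
    exact absurd (hmin e ⟨he, not_lt.1 hcon⟩) (not_le.2 hec)
  -- This is the submartingale property of exp(B) on `D a`. The event is a functional `φ` of the
  -- path up to `a`, and exp(B_T - B_a) is a functional `ψ` of the independent shifted path, with
  -- expectation at least 1.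
  have hstep : ∀ a ∈ I, P (D a) * ENNReal.ofReal (Real.exp x) ≤
      ∫⁻ ω in D a, ENNReal.ofReal (Real.exp (B T ω)) ∂P := by
    intro a ha
    let φ : (Iic a → ℝ) → ℝ≥0∞ := {y | x ≤ y ⟨a, self_mem_Iic⟩ ∧
      ∀ c : Iic a, c.1 ∈ I → c.1 < a → y c < x}.indicator
        fun y => ENNReal.ofReal (Real.exp (y ⟨a, self_mem_Iic⟩))
    have hφ : Measurable φ := by
      refine Measurable.indicator (by fun_prop) ?_
      refine (measurableSet_le measurable_const (measurable_pi_apply _)).inter ?_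
      have : {y : Iic a → ℝ | ∀ c : Iic a, c.1 ∈ I → c.1 < a → y c < x} =
          ⋂ c ∈ {c : Iic a | c.1 ∈ I ∧ c.1 < a}, {y | y c < x} := by
        ext; simp
      change MeasurableSet {y : Iic a → ℝ | ∀ c : Iic a, c.1 ∈ I → c.1 < a → y c < x}
      rw [this]
      refine MeasurableSet.biInter (Set.Finite.countable ?_) fun c _ =>
        measurableSet_lt (measurable_pi_apply _) measurable_const
      refine Set.Finite.of_finite_image (f := Subtype.val) (I.finite_toSet.subset ?_)
        Subtype.val_injective.injOn
      rintro _ ⟨c, hc, rfl⟩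
      exact hc.1
    let ψ : (ℝ≥0 → ℝ) → ℝ≥0∞ := fun y => ENNReal.ofReal (Real.exp (y (T - a)))
    have hψ : Measurable ψ := by fun_prop
    have hind := (hB.indepFun_shift a).comp hψ hφ
    have hprod := lintegral_mul_eq_lintegral_mul_lintegral_of_indepFun''
      (hψ.comp (measurable_pi_lambda _ fun t => (hm (a + t)).sub (hm a))).aemeasurable
      (hφ.comp (measurable_pi_lambda _ fun t => hm t)).aemeasurable hind
    have hφD : ∀ ω, φ (fun t : Iic a => B t ω) =
        (D a).indicator (fun ω => ENNReal.ofReal (Real.exp (B a ω))) ω := by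
      intro ω
      by_cases hω : ω ∈ D a
      · rw [indicator_of_mem hω]
        exact indicator_of_mem (s := {y : Iic a → ℝ | x ≤ y ⟨a, self_mem_Iic⟩ ∧
          ∀ c : Iic a, c.1 ∈ I → c.1 < a → y c < x}) ⟨hω.1, fun c => hω.2 c⟩ _
      · rw [indicator_of_notMem hω]
        exact indicator_of_notMem
          (fun h => hω ⟨h.1, fun c hc hca => h.2 ⟨c, hca.le⟩ hc hca⟩) _
    have hone : 1 ≤ ∫⁻ ω, ψ (fun t => B (a + t) ω - B a ω) ∂P := by
      have := lintegral_exp_of_hasLaw_gaussianReal ((hB.shift a).hasLaw_eval (T - a))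
      simp only [ψ]
      rw [this, ENNReal.one_le_ofReal, Real.one_le_exp_iff]
      positivity
    calc P (D a) * ENNReal.ofReal (Real.exp x)
        = ∫⁻ _ in D a, ENNReal.ofReal (Real.exp x) ∂P := by
          rw [setLIntegral_const, mul_comm]
      _ ≤ ∫⁻ ω in D a, ENNReal.ofReal (Real.exp (B a ω)) ∂P := by
          refine setLIntegral_mono' (hDm a) fun ω hω => ?_
          exact ENNReal.ofReal_le_ofReal (Real.exp_le_exp.2 hω.1)
      _ = ∫⁻ ω, φ (fun t : Iic a => B t ω) ∂P := by
          rw [← lintegral_indicator (hDm a)]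
          exact lintegral_congr fun ω => (hφD ω).symm
      _ ≤ (∫⁻ ω, ψ (fun t => B (a + t) ω - B a ω) ∂P) *
            ∫⁻ ω, φ (fun t : Iic a => B t ω) ∂P := le_mul_of_one_le_left' hone
      _ = ∫⁻ ω, ψ (fun t => B (a + t) ω - B a ω) * φ (fun t : Iic a => B t ω) ∂P := hprod.symm
      _ = ∫⁻ ω in D a, ENNReal.ofReal (Real.exp (B T ω)) ∂P := by
          rw [← lintegral_indicator (hDm a)]
          refine lintegral_congr fun ω => ?_
          rw [hφD]
          by_cases hω : ω ∈ D a
          · simp only [indicator_of_mem hω, ψ]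
            rw [← ENNReal.ofReal_mul (Real.exp_pos _).le, ← Real.exp_add,
              add_tsub_cancel_of_le (hI a ha), sub_add_cancel]
          · simp [indicator_of_notMem hω]
  calc P {ω | ∃ a ∈ I, x ≤ B a ω} * ENNReal.ofReal (Real.exp x)
      ≤ (∑ a ∈ I, P (D a)) * ENNReal.ofReal (Real.exp x) := by
        gcongr
        exact (measure_mono hcover).trans (measure_biUnion_finset_le _ _)
    _ ≤ ∑ a ∈ I, ∫⁻ ω in D a, ENNReal.ofReal (Real.exp (B T ω)) ∂P := by
        rw [Finset.sum_mul]
        exact Finset.sum_le_sum hstep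
    _ = ∫⁻ ω in ⋃ a ∈ I, D a, ENNReal.ofReal (Real.exp (B T ω)) ∂P :=
        (lintegral_biUnion_finset hdisj (fun a _ => hDm a) _).symm
    _ ≤ ∫⁻ ω, ENNReal.ofReal (Real.exp (B T ω)) ∂P := setLIntegral_le_lintegral _ _
    _ = ENNReal.ofReal (Real.exp (T / 2)) :=
        lintegral_exp_of_hasLaw_gaussianReal (hB.hasLaw_eval T)

lemma measure_exists_le_brownian_le (hB : IsPreBrownianReal B P) (hm : ∀ a, Measurable (B a))
    {T : ℝ≥0} (I : Finset ℝ≥0) (hI : ∀ a ∈ I, a ≤ T) (x : ℝ) :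
    P {ω | ∃ a ∈ I, x ≤ B a ω} ≤ ENNReal.ofReal (Real.exp (T / 2 - x)) := by
  have h := measure_exists_le_brownian_mul_le hB hm I hI x
  rw [Real.exp_sub, ENNReal.ofReal_div_of_pos (Real.exp_pos x)]
  rw [ENNReal.le_div_iff_mul_le (Or.inl (by simp [Real.exp_pos])) (Or.inl ENNReal.ofReal_ne_top)]
  exact h

lemma measurable_pathSup (T : ℝ≥0) : Measurable (pathSup T) :=
  Measurable.iSup fun _ => (measurable_pi_apply _).enorm

/-- The supremum is over countably many times, so the event is an increasing union of events at
finitely many times, on which the maximal inequality is uniform. The factor 2 comes from applying it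
to B and to -B. -/
lemma measure_lt_pathSup_le (hB : IsPreBrownianReal B P) (hm : ∀ a, Measurable (B a))
    (T : ℝ≥0) (m : ℕ) :
    P {ω | (m : ℝ≥0∞) < pathSup T fun a => B a ω} ≤
      2 * ENNReal.ofReal (Real.exp (T / 2 - m)) := by
  let d : ℕ → Iic T := TopologicalSpace.denseSeq (Iic T)
  let E : ℕ → Set Ω := fun k => {ω | ∃ j < k, (m : ℝ≥0∞) < ‖B (d j) ω‖ₑ}
  have hE : {ω | (m : ℝ≥0∞) < pathSup T fun a => B a ω} = ⋃ k, E k := by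
    ext ω
    simp only [pathSup, lt_iSup_iff, mem_ofPred_eq, mem_iUnion, E]
    exact ⟨fun ⟨j, hj⟩ => ⟨j + 1, j, j.lt_succ_self, hj⟩, fun ⟨_, j, _, hj⟩ => ⟨j, hj⟩⟩
  have hmono : Monotone E := fun k l hkl ω ⟨j, hj, h⟩ => ⟨j, hj.trans_le hkl, h⟩
  rw [hE, hmono.measure_iUnion]
  refine iSup_le fun k => ?_
  let I : Finset ℝ≥0 := (Finset.range k).image fun j => (d j : ℝ≥0)
  have hI : ∀ a ∈ I, a ≤ T := by
    intro a ha
    obtain ⟨j, -, rfl⟩ := Finset.mem_image.1 ha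
    exact (d j).2
  have hsub : E k ⊆ {ω | ∃ a ∈ I, (m : ℝ) ≤ B a ω} ∪ {ω | ∃ a ∈ I, (m : ℝ) ≤ (-B) a ω} := by
    rintro ω ⟨j, hj, h⟩
    have hmem : (d j : ℝ≥0) ∈ I := Finset.mem_image_of_mem _ (Finset.mem_range.2 hj)
    rw [Real.enorm_eq_ofReal_abs, ← ENNReal.ofReal_natCast,
      ENNReal.ofReal_lt_ofReal_iff_of_nonneg (by positivity)] at h
    rcases le_abs.1 h.le with h | h
    · exact Or.inl ⟨_, hmem, h⟩
    · exact Or.inr ⟨_, hmem, h⟩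
  rw [two_mul]
  refine (measure_mono hsub).trans ((measure_union_le _ _).trans (add_le_add ?_ ?_))
  · exact measure_exists_le_brownian_le hB hm I hI m
  · exact measure_exists_le_brownian_le hB.neg (fun a => (hm a).neg) I hI m

/-- A bound for the `q`-th moment of `1 + ξ + sup |B|`. -/
noncomputable def momentBound (ξ : ℝ) (T : ℝ≥0) (q : ℕ) : ℝ≥0∞ :=
  (2 + ENNReal.ofReal ξ) ^ q +
    ∑' m : ℕ, (m + 2 + ENNReal.ofReal ξ) ^ q * (2 * ENNReal.ofReal (Real.exp (T / 2 - m)))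

lemma momentBound_ne_top (ξ : ℝ) (T : ℝ≥0) (q : ℕ) : momentBound ξ T q ≠ ∞ := by
  refine ENNReal.add_ne_top.2 ⟨by finiteness, ?_⟩
  -- The comparison m + 2 + ξ ≤ (3 + ξ)(m + 1) reduces the series to powers of m + 1 times exp(-(m +
  -- 1)); the shift avoids a vanishing power at m = 0. `max ξ 0` reflects the truncation in
  -- `ENNReal.ofReal`.
  have hterm : ∀ m : ℕ, ((m : ℝ≥0∞) + 2 + ENNReal.ofReal ξ) ^ q *
      (2 * ENNReal.ofReal (Real.exp (T / 2 - m))) ≤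
      ENNReal.ofReal ((3 + max ξ 0) ^ q * 2 * Real.exp (T / 2) *
        (Real.exp 1 * (((m + 1 : ℕ) : ℝ) ^ q * Real.exp (-1 * ((m + 1 : ℕ) : ℝ))))) := by
    intro m
    have h1 : (m : ℝ≥0∞) + 2 + ENNReal.ofReal ξ = ENNReal.ofReal (m + 2 + max ξ 0) := by
      rw [ENNReal.ofReal_add (by positivity) (by positivity),
        ENNReal.ofReal_add (by positivity) (by positivity)]
      simp
    rw [h1, ← ENNReal.ofReal_pow (by positivity), show (2 : ℝ≥0∞) = ENNReal.ofReal 2 by simp,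
      ← ENNReal.ofReal_mul (by norm_num), ← ENNReal.ofReal_mul (by positivity)]
    refine ENNReal.ofReal_le_ofReal ?_
    have h2 : Real.exp (T / 2 - m) =
        Real.exp (T / 2) * (Real.exp 1 * Real.exp (-1 * ((m + 1 : ℕ) : ℝ))) := by
      rw [← Real.exp_add, ← Real.exp_add]
      congr 1
      push_cast
      ring
    have h3 : ((m : ℝ) + 2 + max ξ 0) ^ q ≤ (3 + max ξ 0) ^ q * ((m + 1 : ℕ) : ℝ) ^ q := by
      rw [← mul_pow]
      refine pow_le_pow_left₀ (by positivity) ?_ q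
      push_cast
      have : 0 ≤ (m : ℝ) * max ξ 0 := by positivity
      nlinarith [(Nat.cast_nonneg m : (0 : ℝ) ≤ m)]
    rw [h2]
    calc _ ≤ ((3 + max ξ 0) ^ q * ((m + 1 : ℕ) : ℝ) ^ q) *
          (2 * (Real.exp (T / 2) * (Real.exp 1 * Real.exp (-1 * ((m + 1 : ℕ) : ℝ))))) := by gcongr
      _ = _ := by ring
  refine ne_top_of_le_ne_top ?_ (ENNReal.tsum_le_tsum hterm)
  refine Summable.tsum_ofReal_ne_top ?_
  refine Summable.mul_left _ (Summable.mul_left _ ?_)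
  exact (summable_nat_add_iff 1).2 (Real.summable_pow_mul_exp_neg_nat_mul q one_pos)

/-- A discrete layer decomposition: for S in (m, m + 1] with m ≥ 1 the single term m suffices, the
leading term covers S ≤ 1, and for S = ∞ the series diverges because all its terms are at least 1.
-/
lemma pow_le_layers (ξ : ℝ) (q : ℕ) (S : ℝ≥0∞) :
    (1 + ENNReal.ofReal ξ + S) ^ q ≤ (2 + ENNReal.ofReal ξ) ^ q +
      ∑' m : ℕ, (m + 2 + ENNReal.ofReal ξ) ^ q * (if (m : ℝ≥0∞) < S then 1 else 0) := by
  induction S with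
  | top =>
    have : ∑' m : ℕ, ((m : ℝ≥0∞) + 2 + ENNReal.ofReal ξ) ^ q *
        (if (m : ℝ≥0∞) < ∞ then 1 else 0) = ∞ := by
      rw [eq_top_iff]
      calc ∞ = ∑' _ : ℕ, (1 : ℝ≥0∞) := (ENNReal.tsum_const_eq_top_of_ne_zero one_ne_zero).symm
        _ ≤ _ := by
          refine ENNReal.tsum_le_tsum fun m => ?_
          rw [if_pos (ENNReal.natCast_lt_top m), mul_one, add_right_comm]
          refine one_le_pow₀ ?_
          exact (show (1 : ℝ≥0∞) ≤ 2 by norm_num).trans le_add_self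
    rw [this, add_top]
    exact le_top
  | coe r =>
    rcases le_or_gt r 1 with h | h
    · refine le_trans ?_ le_self_add
      refine pow_le_pow_left' ?_ q
      calc _ ≤ 1 + ENNReal.ofReal ξ + 1 := by gcongr; exact_mod_cast h
        _ = _ := by rw [add_right_comm, one_add_one_eq_two]
    · refine le_trans ?_ le_add_self
      have hc : 0 < ⌈r⌉₊ := Nat.ceil_pos.2 (zero_lt_one.trans h)
      obtain ⟨m, hm⟩ := Nat.exists_eq_succ_of_ne_zero hc.ne'
      have h1 : (m : ℝ≥0∞) < r := by
        have : m < ⌈r⌉₊ := by omega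
        exact_mod_cast Nat.lt_ceil.1 this
      have h2 : (r : ℝ≥0∞) ≤ m + 1 := by
        have := Nat.le_ceil r
        rw [hm] at this
        exact_mod_cast this
      refine le_trans ?_ (ENNReal.le_tsum m)
      rw [if_pos h1, mul_one]
      refine pow_le_pow_left' ?_ q
      calc _ ≤ 1 + ENNReal.ofReal ξ + (m + 1) := by gcongr
        _ = m + (1 + 1) + ENNReal.ofReal ξ := by ring
        _ = _ := by rw [one_add_one_eq_two]

lemma lintegral_pathSup_pow_le [IsProbabilityMeasure P] (hB : IsPreBrownianReal B P)
    (hm : ∀ a, Measurable (B a)) (ξ : ℝ) (T : ℝ≥0) (q : ℕ) :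
    ∫⁻ ω, (1 + ENNReal.ofReal ξ + pathSup T fun a => B a ω) ^ q ∂P ≤ momentBound ξ T q := by
  have hS : Measurable fun ω => pathSup T fun a => B a ω :=
    (measurable_pathSup T).comp (measurable_pi_lambda _ hm)
  have hset : ∀ m : ℕ, MeasurableSet {ω | (m : ℝ≥0∞) < pathSup T fun a => B a ω} :=
    fun m => measurableSet_lt measurable_const hS
  have hind : ∀ m : ℕ, (fun ω => (if (m : ℝ≥0∞) < pathSup T (fun a => B a ω) then 1 else 0 : ℝ≥0∞))
      = {ω | (m : ℝ≥0∞) < pathSup T fun a => B a ω}.indicator 1 := by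
    intro m
    ext ω
    simp [indicator]
  refine (lintegral_mono fun ω => pow_le_layers ξ q _).trans ?_
  have hmeas : ∀ m : ℕ, Measurable
      fun ω => (if (m : ℝ≥0∞) < pathSup T (fun a => B a ω) then 1 else 0 : ℝ≥0∞) := by
    intro m
    rw [hind]
    exact measurable_one.indicator (hset m)
  rw [lintegral_add_left measurable_const, lintegral_const, measure_univ, mul_one,
    lintegral_tsum fun m => ((hmeas m).const_mul _).aemeasurable]
  refine add_le_add_right (ENNReal.tsum_le_tsum fun m => ?_) _
  rw [lintegral_const_mul _ (hmeas m), hind, lintegral_indicator_one (hset m)]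
  gcongr
  exact measure_lt_pathSup_le hB hm T m

end Brownian

/-! ### The exponential law -/

lemma lintegral_exp_neg_expMeasure {lam : ℝ} (hlam : 0 ≤ lam) :
    ∫⁻ x, ENNReal.ofReal (Real.exp (-lam * x)) ∂(expMeasure 1) = ENNReal.ofReal (1 / (1 + lam)) := by
  -- Exponential tilting turns the density of rate 1 into a multiple of the density of rate 1 + λ,
  -- whose total mass is known.
  have hpdf : ∀ x, exponentialPDF 1 x * ENNReal.ofReal (Real.exp (-lam * x)) =
      ENNReal.ofReal (1 / (1 + lam)) * exponentialPDF (1 + lam) x := by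
    intro x
    rcases lt_or_ge x 0 with h | h
    · simp [exponentialPDF_of_neg h]
    · rw [exponentialPDF_of_nonneg h, exponentialPDF_of_nonneg h,
        ← ENNReal.ofReal_mul (by positivity), ← ENNReal.ofReal_mul (by positivity)]
      congr 1
      rw [one_mul, ← Real.exp_add]
      field_simp
      ring_nf
  have hmeas : ∀ r, Measurable (exponentialPDF r) := fun r =>
    (measurable_exponentialPDFReal r).ennreal_ofReal
  change ∫⁻ x, ENNReal.ofReal (Real.exp (-lam * x)) ∂(volume.withDensity (exponentialPDF 1)) = _
  rw [lintegral_withDensity_eq_lintegral_mul _ (hmeas 1) (by fun_prop)]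
  simp only [Pi.mul_apply, hpdf]
  rw [lintegral_const_mul _ (hmeas _), lintegral_exponentialPDF_eq_one (by positivity), mul_one]

lemma ae_nonneg_expMeasure : ∀ᵐ x ∂(expMeasure 1), 0 ≤ x := by
  rw [ae_iff]
  change (volume.withDensity (exponentialPDF 1)) _ = 0
  have : {x : ℝ | ¬ 0 ≤ x} = Iio 0 := by ext; simp
  rw [this, withDensity_apply _ measurableSet_Iio]
  refine (setLIntegral_congr_fun measurableSet_Iio fun x hx => exponentialPDF_of_neg hx).trans ?_
  simp


/-! ### Sums over genealogies -/

/-- A list of natural numbers is empty or has a head and a tail. -/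
def listEquiv : Unit ⊕ ℕ × List ℕ ≃ List ℕ where
  toFun
    | .inl _ => []
    | .inr (k, l) => k :: l
  invFun
    | [] => .inl ()
    | k :: l => .inr (k, l)
  left_inv x := by rcases x with _ | ⟨k, l⟩ <;> rfl
  right_inv l := by cases l <;> rfl

lemma tsum_list_eq (f : List ℕ → ℝ≥0∞) : ∑' l, f l = f [] + ∑' k, ∑' l, f (k :: l) := by
  rw [← listEquiv.tsum_eq, Summable.tsum_sum ENNReal.summable ENNReal.summable,
    ENNReal.tsum_prod', tsum_fintype]
  simp [listEquiv]

/-- Splitting off the head shows that the sum S_m over lists of length at most m satisfies S_(m+1) =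
1 + (∑ g) S_m, and 1 + 2⁻¹ * 2 = 2 preserves the bound. Truncating by length avoids solving an
equation for a possibly infinite total; every finite set of lists has bounded length. -/
lemma tsum_list_prod_le_two {g : ℕ → ℝ≥0∞} (hg : ∑' k, g k ≤ 2⁻¹) :
    ∑' l : List ℕ, (l.map g).prod ≤ 2 := by
  have hlev : ∀ m : ℕ, ∑' l : List ℕ, (if l.length ≤ m then (l.map g).prod else 0) ≤ 2 := by
    intro m
    induction m with
    | zero =>
      rw [tsum_list_eq]
      simp
    | succ m ih =>
      rw [tsum_list_eq]
      calc _ = 1 + ∑' k, ∑' l : List ℕ, g k * (if l.length ≤ m then (l.map g).prod else 0) := by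
            simp
        _ = 1 + (∑' k, g k) * ∑' l : List ℕ, (if l.length ≤ m then (l.map g).prod else 0) := by
            simp_rw [ENNReal.tsum_mul_left, ENNReal.tsum_mul_right]
        _ ≤ 1 + 2⁻¹ * 2 := by gcongr
        _ = 2 := by
            rw [ENNReal.inv_mul_cancel (by norm_num) (by norm_num), one_add_one_eq_two]
  rw [ENNReal.tsum_eq_iSup_sum]
  refine iSup_le fun F => ?_
  refine le_trans ?_ (hlev (F.sup List.length))
  refine le_trans (Finset.sum_le_sum fun l hl => ?_) (ENNReal.sum_le_tsum F)
  rw [if_pos (Finset.le_sup (f := List.length) hl)]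

/-! ### The expected contribution of a lineage -/

/-- Measurability is with respect to the σ-algebra of the single source `j`, so that independence of
the sources passes to the factors. -/
lemma measurable_noiseSigma_factor {Ω : Type*} {n : ℕ} {B : Label n → ℝ≥0 → Ω → ℝ}
    {τ Z : Label n → ℕ → Ω → ℝ} (x₀ : Fin n → Ω → ℝ) (ξ : ℝ) (T : ℝ≥0) (lam : ℝ) (q : ℕ)
    (j : NoiseIndex n) : Measurable[noiseSigma B τ Z j]
      fun ω => (sampleAt x₀ B τ Z ω).factor ξ T lam q j := by
  rcases j with u | v | v
  · have h : Measurable fun f : ℝ≥0 → ℝ => (1 + ENNReal.ofReal ξ + pathSup T f) ^ q :=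
      ((measurable_pathSup T).const_add _).pow_const q
    exact h.comp (comap_measurable _)
  · have h : Measurable fun x : ℝ => ENNReal.ofReal (Real.exp (-lam * x)) := by fun_prop
    exact h.comp (comap_measurable (τ v.1 v.2))
  · exact measurable_const

section Noise

variable {Ω : Type*} [MeasurableSpace Ω] {P : Measure Ω} {n : ℕ} {p : ℝ → ℝ → ℝ}
  {B : Label n → ℝ≥0 → Ω → ℝ} {τ Z : Label n → ℕ → Ω → ℝ}

lemma IsNoise.noiseSigma_le (h : IsNoise p B τ Z P) (j : NoiseIndex n) :
    noiseSigma B τ Z j ≤ ‹MeasurableSpace Ω› := by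
  rcases j with u | v | v
  · exact (measurable_pi_lambda _ (h.measurable_path u)).comap_le
  · exact (h.measurable_clock _ _).comap_le
  · exact (h.measurable_jump _ _).comap_le

lemma IsNoise.measurable_factor (h : IsNoise p B τ Z P) (x₀ : Fin n → Ω → ℝ) (ξ : ℝ) (T : ℝ≥0)
    (lam : ℝ) (q : ℕ) (j : NoiseIndex n) :
    Measurable fun ω => (sampleAt x₀ B τ Z ω).factor ξ T lam q j :=
  (measurable_noiseSigma_factor x₀ ξ T lam q j).mono (h.noiseSigma_le j) le_rfl

lemma IsNoise.lintegral_prod_factor_le [IsProbabilityMeasure P] (h : IsNoise p B τ Z P)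
    (x₀ : Fin n → Ω → ℝ) (ξ : ℝ) (T : ℝ≥0) {lam : ℝ} (hlam : 0 ≤ lam) (q : ℕ) (i : Fin n)
    (l : List ℕ) :
    ∫⁻ ω, ∏ j ∈ lineage i l, (sampleAt x₀ B τ Z ω).factor ξ T lam q j ∂P ≤
      momentBound ξ T q *
        (l.map fun k => momentBound ξ T q * ENNReal.ofReal (1 / (1 + lam)) ^ (k + 1)).prod := by
  have hind : iIndepFun (fun j ω => (sampleAt x₀ B τ Z ω).factor ξ T lam q j) P := by
    rw [iIndepFun_iff_iIndep]
    exact iIndep_of_iIndep_of_le h.indep fun j =>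
      (measurable_noiseSigma_factor x₀ ξ T lam q j).comap_le
  rw [lintegral_prod_eq_prod_lintegral_of_indepFun _ _ hind fun j =>
    h.measurable_factor x₀ ξ T lam q j]
  have hpath : ∀ u, ∫⁻ ω, (sampleAt x₀ B τ Z ω).factor ξ T lam q (.inl u) ∂P ≤
      momentBound ξ T q := fun u =>
    lintegral_pathSup_pow_le (h.brownian u).toIsPreBrownianReal (h.measurable_path u) ξ T q
  have hclock : ∀ v, ∫⁻ ω, (sampleAt x₀ B τ Z ω).factor ξ T lam q (.inr (.inl v)) ∂P =
      ENNReal.ofReal (1 / (1 + lam)) := by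
    intro v
    rw [← lintegral_exp_neg_expMeasure hlam, ← (h.clock_law v.1 v.2).map_eq,
      lintegral_map (by fun_prop) (h.measurable_clock _ _)]
    rfl
  induction l with
  | nil => simpa [lineage] using hpath (i, [])
  | cons k l ih =>
    rw [prod_lineage_cons]
    simp only [hclock, Finset.prod_const, Finset.card_range, List.map_cons, List.prod_cons]
    calc _ ≤ (momentBound ξ T q * (l.map fun k => momentBound ξ T q *
          ENNReal.ofReal (1 / (1 + lam)) ^ (k + 1)).prod) *
          (ENNReal.ofReal (1 / (1 + lam)) ^ (k + 1) * momentBound ξ T q) := by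
          gcongr
          exact hpath _
      _ = _ := by ring

lemma tsum_pow_inv_one_add {lam : ℝ} (hlam : 0 < lam) :
    ∑' k : ℕ, ENNReal.ofReal (1 / (1 + lam)) ^ (k + 1) = ENNReal.ofReal (1 / lam) := by
  have h0 : 0 ≤ 1 / (1 + lam) := by positivity
  have h1 : 1 / (1 + lam) < 1 := by rw [div_lt_one (by positivity)]; linarith
  simp_rw [pow_succ, ENNReal.tsum_mul_right, ← ENNReal.ofReal_pow h0]
  rw [← ENNReal.ofReal_tsum_of_nonneg (fun k => by positivity) (summable_geometric_of_lt_one h0 h1),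
    tsum_geometric_of_lt_one h0 h1, ← ENNReal.ofReal_mul (inv_nonneg.2 (by linarith))]
  congr 1
  have : 1 - 1 / (1 + lam) = lam / (1 + lam) := by field_simp; ring
  rw [this]
  field_simp

/-- The rate of the exponential weight that makes the sum over all genealogies converge. -/
noncomputable def discount (ξ : ℝ) (T : ℝ≥0) (q : ℕ) : ℝ := 2 * ((momentBound ξ T q).toReal + 1)

lemma discount_pos (ξ : ℝ) (T : ℝ≥0) (q : ℕ) : 0 < discount ξ T q := by
  have := ENNReal.toReal_nonneg (a := momentBound ξ T q)
  unfold discount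
  positivity

lemma IsNoise.tsum_lintegral_prod_factor_le [IsProbabilityMeasure P] (h : IsNoise p B τ Z P)
    (x₀ : Fin n → Ω → ℝ) (ξ : ℝ) (T : ℝ≥0) (q : ℕ) :
    ∑' u : Label n, ∫⁻ ω, ∏ j ∈ lineage u.1 u.2,
      (sampleAt x₀ B τ Z ω).factor ξ T (discount ξ T q) q j ∂P ≤ n * (momentBound ξ T q * 2) := by
  have hpos := discount_pos ξ T q
  -- The geometric series leaves C / `discount` = C / (2(C + 1)), which is at most 1/2.
  have hg : ∑' k : ℕ, momentBound ξ T q *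
      ENNReal.ofReal (1 / (1 + discount ξ T q)) ^ (k + 1) ≤ 2⁻¹ := by
    rw [ENNReal.tsum_mul_left, tsum_pow_inv_one_add hpos,
      ← ENNReal.ofReal_toReal (momentBound_ne_top ξ T q), ← ENNReal.ofReal_mul (by positivity),
      show (2⁻¹ : ℝ≥0∞) = ENNReal.ofReal 2⁻¹ by
        rw [ENNReal.ofReal_inv_of_pos two_pos, ENNReal.ofReal_ofNat]]
    refine ENNReal.ofReal_le_ofReal ?_
    have := ENNReal.toReal_nonneg (a := momentBound ξ T q)
    rw [discount]
    field_simp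
    linarith
  rw [ENNReal.tsum_prod']
  calc _ ≤ ∑' _ : Fin n, momentBound ξ T q * 2 := by
        refine ENNReal.tsum_le_tsum fun i => ?_
        refine (ENNReal.tsum_le_tsum fun l =>
          h.lintegral_prod_factor_le x₀ ξ T hpos.le q i l).trans ?_
        rw [ENNReal.tsum_mul_left]
        gcongr
        exact tsum_list_prod_le_two hg
    _ = _ := by simp [tsum_fintype]

/-! ### Almost sure regularity and the escape probability -/

lemma ae_of_hasLaw_withDensity {X : Ω → ℝ} {f : ℝ → ℝ} (hf : Continuous f) {S : Set ℝ}
    (hX : HasLaw X (volume.withDensity fun z => ENNReal.ofReal (f z)) P)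
    (h0 : ∀ z ∉ S, f z = 0) : ∀ᵐ ω ∂P, X ω ∈ S := by
  refine ae_of_ae_map hX.aemeasurable (p := fun z => z ∈ S) ?_
  rw [hX.map_eq, ae_withDensity_iff (by fun_prop)]
  refine ae_of_all _ fun z hz => ?_
  by_contra hcon
  exact hz (by rw [h0 z hcon, ENNReal.ofReal_zero])

lemma IsNoise.ae_isRegular (h : IsNoise p B τ Z P) {ξ A : ℝ} (hp : IsJumpDensity p ξ)
    {x₀ : Fin n → Ω → ℝ} (hx : ∀ᵐ ω ∂P, ∀ i, |x₀ i ω| ≤ A) :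
    ∀ᵐ ω ∂P, (sampleAt x₀ B τ Z ω).IsRegular ξ A := by
  have h1 : ∀ᵐ ω ∂P, ∀ u k, 0 ≤ τ u k ω := by
    refine ae_all_iff.2 fun u => ae_all_iff.2 fun k => ?_
    refine ae_of_ae_map (h.clock_law u k).aemeasurable (p := fun x => 0 ≤ x) ?_
    rw [(h.clock_law u k).map_eq]
    exact ae_nonneg_expMeasure
  have h2 : ∀ᵐ ω ∂P, ∀ u, Continuous fun a => B u a ω :=
    ae_all_iff.2 fun u => (h.brownian u).cont
  have h3 : ∀ᵐ ω ∂P, ∀ u k, Z u k ω ∈ {z : ℝ | |z| ≤ ξ} := by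
    refine ae_all_iff.2 fun u => ae_all_iff.2 fun k => ?_
    refine ae_of_hasLaw_withDensity hp.smooth.continuous
      (h.jump_law u k) fun z hz => ?_
    exact hp.finite_range z (not_le.1 hz).le
  filter_upwards [h1, h2, h3, hx] with ω a1 a2 a3 a4
  exact ⟨a1, a2, a3, a4⟩

/-- The constant of the moment bound. -/
noncomputable def escapeBound (ξ A : ℝ) (T : ℝ≥0) (q : ℕ) : ℝ≥0∞ :=
  ENNReal.ofReal (Real.exp (discount ξ T q * T)) * (1 + ENNReal.ofReal A) ^ q *
    (momentBound ξ T q * 2)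

lemma escapeBound_ne_top (ξ A : ℝ) (T : ℝ≥0) (q : ℕ) : escapeBound ξ A T q ≠ ∞ := by
  have := momentBound_ne_top ξ T q
  unfold escapeBound
  finiteness

/-- The probability that some particle leaves `[-R, R]` before time `T`. -/
lemma IsNoise.measure_not_confined_mul_le [IsProbabilityMeasure P] (h : IsNoise p B τ Z P)
    {ξ A : ℝ} (hp : IsJumpDensity p ξ) {x₀ : Fin n → Ω → ℝ} (hx : ∀ᵐ ω ∂P, ∀ i, |x₀ i ω| ≤ A)
    (T : ℝ≥0) (q : ℕ) (R : ℝ) :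
    P {ω | ¬ ∀ t ∈ Icc (0 : ℝ) T, (sampleAt x₀ B τ Z ω).Confined ((sampleAt x₀ B τ Z ω).basic t) t R}
      * ENNReal.ofReal R ^ q ≤ n * escapeBound ξ A T q := by
  set D := ENNReal.ofReal (Real.exp (discount ξ T q * T)) * (1 + ENNReal.ofReal A) ^ q with hD
  let f : Label n → Ω → ℝ≥0∞ := fun u ω =>
    D * ∏ j ∈ lineage u.1 u.2, (sampleAt x₀ B τ Z ω).factor ξ T (discount ξ T q) q j
  have hf : ∀ u, Measurable (f u) := fun u =>
    (Finset.measurable_fun_prod _ fun j _ => h.measurable_factor x₀ ξ T _ q j).const_mul D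
  -- Off the null set of irregular realisations, an escape at any time makes the bound of some label
  -- large. Times have disappeared, leaving a countable union to which Markov's inequality applies
  -- label by label.
  have hsub : {ω | ¬ ∀ t ∈ Icc (0 : ℝ) T,
      (sampleAt x₀ B τ Z ω).Confined ((sampleAt x₀ B τ Z ω).basic t) t R} ≤ᵐ[P]
      (⋃ u, {ω | ENNReal.ofReal R ^ q ≤ f u ω} : Set Ω) := by
    filter_upwards [h.ae_isRegular hp hx] with ω hreg hω
    change ¬ _ at hω
    simp only [Sample.Confined, not_forall] at hω
    obtain ⟨t, ht, u, hu, hR⟩ := hω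
    exact mem_iUnion.2 ⟨u, hreg.le_prod_factor (discount_pos ξ T q).le q ht.2 hu hR⟩
  calc _ ≤ (∑' u, P {ω | ENNReal.ofReal R ^ q ≤ f u ω}) * ENNReal.ofReal R ^ q := by
        gcongr
        exact (measure_mono_ae hsub).trans (measure_iUnion_le _)
    _ = ∑' u, ENNReal.ofReal R ^ q * P {ω | ENNReal.ofReal R ^ q ≤ f u ω} := by
        rw [mul_comm, ENNReal.tsum_mul_left]
    _ ≤ ∑' u, ∫⁻ ω, f u ω ∂P := ENNReal.tsum_le_tsum fun u => mul_meas_ge_le_lintegral (hf u) _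
    _ = D * ∑' u : Label n, ∫⁻ ω, ∏ j ∈ lineage u.1 u.2,
          (sampleAt x₀ B τ Z ω).factor ξ T (discount ξ T q) q j ∂P := by
        rw [← ENNReal.tsum_mul_left]
        refine tsum_congr fun u => lintegral_const_mul _ ?_
        exact Finset.measurable_fun_prod _ fun j _ => h.measurable_factor x₀ ξ T _ q j
    _ ≤ D * (n * (momentBound ξ T q * 2)) := by
        gcongr
        exact h.tsum_lintegral_prod_factor_le x₀ ξ T q
    _ = _ := by rw [escapeBound, ← hD]; ring

/-- `E` need not be measurable: the witness is the complement of a measurable hull of `Eᶜ`, which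
has the same measure as `Eᶜ`. -/
lemma probAtLeast_of_measure_compl_le [IsProbabilityMeasure P] {E : Set Ω} {ε : ℝ} (hε : 0 ≤ ε)
    (h : P Eᶜ ≤ ENNReal.ofReal ε) : ProbAtLeast P E (1 - ε) := by
  refine ⟨(toMeasurable P Eᶜ)ᶜ, (measurableSet_toMeasurable _ _).compl,
    compl_subset_comm.1 (subset_toMeasurable _ _), ?_⟩
  rw [probReal_compl_eq_one_sub (measurableSet_toMeasurable _ _), measureReal_def,
    measure_toMeasurable]
  exact sub_le_sub_left (ENNReal.toReal_le_of_le_ofReal hε h) 1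

lemma ProbAtLeast.mono {E F : Set Ω} {r : ℝ} (h : ProbAtLeast P E r) (hEF : E ⊆ F) :
    ProbAtLeast P F r := by
  obtain ⟨G, hG, hGE, hr⟩ := h
  exact ⟨G, hG, hGE.trans hEF, hr⟩

/-- The basic process started from at most `N` particles in `[-A, A]` stays in `[-N ^ b, N ^ b]`. -/
lemma IsNoise.probAtLeast_confined [IsProbabilityMeasure P] (h : IsNoise p B τ Z P)
    {ξ A : ℝ} (hp : IsJumpDensity p ξ) {x₀ : Fin n → Ω → ℝ} (hx : ∀ᵐ ω ∂P, ∀ i, |x₀ i ω| ≤ A)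
    (T : ℝ≥0) {q : ℕ} {b : ℝ} (hq : 2 ≤ b * q) {N : ℕ} (hN : 1 ≤ N) (hn : n ≤ N) :
    ProbAtLeast P {ω | ∀ t ∈ Icc (0 : ℝ) T,
        (sampleAt x₀ B τ Z ω).Confined ((sampleAt x₀ B τ Z ω).basic t) t ((N : ℝ) ^ b)}
      (1 - (escapeBound ξ A T q).toReal * (N : ℝ)⁻¹) := by
  have hN' : (1 : ℝ) ≤ N := by exact_mod_cast hN
  have hN0 : (N : ℝ≥0∞) ≠ 0 := by exact_mod_cast (by omega : N ≠ 0)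
  refine probAtLeast_of_measure_compl_le (by positivity) ?_
  have key := h.measure_not_confined_mul_le hp hx T q ((N : ℝ) ^ b)
  -- Of the two powers of N, one compensates the number n ≤ N of initial particles and the other
  -- gives the rate 1/N.
  have hpow : (N : ℝ≥0∞) ^ 2 ≤ ENNReal.ofReal ((N : ℝ) ^ b) ^ q := by
    rw [← ENNReal.ofReal_natCast, ← ENNReal.ofReal_pow (by positivity),
      ← ENNReal.ofReal_pow (by positivity)]
    refine ENNReal.ofReal_le_ofReal ?_
    rw [← Real.rpow_mul_natCast (by positivity), ← Real.rpow_natCast]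
    exact Real.rpow_le_rpow_of_exponent_le hN' (by exact_mod_cast hq)
  rw [ENNReal.ofReal_mul ENNReal.toReal_nonneg, ENNReal.ofReal_toReal (escapeBound_ne_top _ _ _ _),
    ENNReal.ofReal_inv_of_pos (by positivity), ENNReal.ofReal_natCast, ← div_eq_mul_inv,
    ENNReal.le_div_iff_mul_le (Or.inl hN0) (Or.inl (ENNReal.natCast_ne_top N))]
  rw [← ENNReal.mul_le_mul_iff_right hN0 (ENNReal.natCast_ne_top N)]
  calc _ = P {ω | ¬ ∀ t ∈ Icc (0 : ℝ) T, (sampleAt x₀ B τ Z ω).Confined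
        ((sampleAt x₀ B τ Z ω).basic t) t ((N : ℝ) ^ b)} * (N : ℝ≥0∞) ^ 2 := by
        rw [sq, mul_comm, mul_assoc]
        rfl
    _ ≤ n * escapeBound ξ A T q := le_trans (by gcongr) key
    _ ≤ _ := by gcongr

end Noise

end BranchingBrownian

/-! ### The theorem -/

open BranchingBrownian in
theorem mainTheorem11 (p : ℝ → ℝ → ℝ) (ξ : ℝ) (hp : IsJumpDensity p ξ)
    (ρ₀ : ℝ → ℝ) (A : ℝ) (hρ₀ : IsInitialDensity ρ₀ A)
    (T : ℝ) (hT : 0 < T) (b : ℝ) (hb : 0 < b) :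
    ∃ c : ℝ, ∀ N : ℕ, 1 ≤ N →
      ∀ (Ω : Type*) [MeasurableSpace Ω] (P : Measure Ω) [IsProbabilityMeasure P],
      -- the basic process, from at most `N` particles in `[-A, A]`
      (∀ n : ℕ, n ≤ N → ∀ y₀ : Fin n → ℝ, (∀ i, y₀ i ∈ Icc (-A) A) →
        ∀ (B : Label n → ℝ≥0 → Ω → ℝ) (τ Z : Label n → ℕ → Ω → ℝ), IsNoise p B τ Z P →
        ProbAtLeast P
          {ω | ∀ t ∈ Icc 0 T, (sampleAt (fun i _ => y₀ i) B τ Z ω).Confined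
            ((sampleAt (fun i _ => y₀ i) B τ Z ω).basic t) t ((N : ℝ) ^ b)}
          (1 - c * (N : ℝ)⁻¹)) ∧
      -- the stochastic barriers, from `N` particles: fixed in `[-A, A]`, or i.i.d. with density `ρ₀`
      (∀ (x₀ : Fin N → Ω → ℝ) (B : Label N → ℝ≥0 → Ω → ℝ) (τ Z : Label N → ℕ → Ω → ℝ),
        IsNoise p B τ Z P →
        ((∃ y₀ : Fin N → ℝ, (∀ i, y₀ i ∈ Icc (-A) A) ∧ x₀ = fun i _ => y₀ i) ∨
          IsIIDStart ρ₀ x₀ B τ Z P) →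
        ∀ δ : ℝ, 0 < δ →
        -- the upper barrier
        ((∀ ω, ∀ k : ℕ, ∀ t ∈ Icc (k * δ) ((k + 1) * δ),
            (sampleAt x₀ B τ Z ω).upper N δ k t ⊆ (sampleAt x₀ B τ Z ω).basic t) ∧
          ProbAtLeast P
            {ω | ∀ k : ℕ, ∀ t ∈ Icc (k * δ) ((k + 1) * δ), t ≤ T →
              (sampleAt x₀ B τ Z ω).Confined
                ((sampleAt x₀ B τ Z ω).upper N δ k t) t ((N : ℝ) ^ b)}
            (1 - c * (N : ℝ)⁻¹)) ∧
        -- the lower barrier, whose initial cut `(1 - e^{-δ}) N + N^α₀` is rounded either way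
        (∀ α₀ ∈ Ioo (1 / 2 : ℝ) 1, ∀ M : ℕ,
          |(M : ℝ) - ((1 - Real.exp (-δ)) * N + (N : ℝ) ^ α₀)| < 1 →
          (∀ ω, ∀ k : ℕ, ∀ t ∈ Icc (k * δ) ((k + 1) * δ),
            (sampleAt x₀ B τ Z ω).lower N M δ k t ⊆ (sampleAt x₀ B τ Z ω).basic t) ∧
          ProbAtLeast P
            {ω | ∀ k : ℕ, ∀ t ∈ Icc (k * δ) ((k + 1) * δ), t ≤ T →
              (sampleAt x₀ B τ Z ω).Confined
                ((sampleAt x₀ B τ Z ω).lower N M δ k t) t ((N : ℝ) ^ b)}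
            (1 - c * (N : ℝ)⁻¹))) := by

  -- The moment order depends on b alone, so the constant is fixed before N, δ, α₀ and the start.
  obtain ⟨q, hq⟩ : ∃ q : ℕ, 2 / b ≤ q := exists_nat_ge _
  rw [div_le_iff₀' hb] at hq
  lift T to ℝ≥0 using hT.le
  refine ⟨(escapeBound ξ A T q).toReal, fun N hN Ω _ P _ => ⟨?_, ?_⟩⟩
  · intro n hn y₀ hy B τ Z hnoise
    exact hnoise.probAtLeast_confined hp (ae_of_all _ fun _ i => abs_le.2 (hy i)) T hq hN hn
  · intro x₀ B τ Z hnoise hstart δ hδ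
    have hx : ∀ᵐ ω ∂P, ∀ i, |x₀ i ω| ≤ A := by
      rcases hstart with ⟨y₀, hy, rfl⟩ | hiid
      · exact ae_of_all _ fun _ i => abs_le.2 (hy i)
      · refine ae_all_iff.2 fun i => ?_
        filter_upwards [ae_of_hasLaw_withDensity hρ₀.smooth.continuous
          (hiid.law i) hρ₀.support] with ω hω using abs_le.2 hω
    -- This one confinement event of the basic process serves both barriers, for all δ and all cuts
    -- M.
    have hmain := hnoise.probAtLeast_confined hp hx T hq hN le_rfl
    have hpos : ∀ {k : ℕ} {t : ℝ}, k * δ ≤ t → 0 ≤ t := fun h => le_trans (by positivity) h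
    refine ⟨⟨fun ω k t ht => Sample.upper_subset_basic _ N hδ k ht.1, hmain.mono ?_⟩,
      fun α₀ _ M _ => ⟨fun ω k t ht => Sample.lower_subset_basic _ N M hδ k ht.1, hmain.mono ?_⟩⟩
    · intro ω hω k t ht htT u hu
      exact hω t ⟨hpos ht.1, htT⟩ u (Sample.upper_subset_basic _ N hδ k ht.1 hu)
    · intro ω hω k t ht htT u hu
      exact hω t ⟨hpos ht.1, htT⟩ u (Sample.lower_subset_basic _ N M hδ k ht.1 hu)
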